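/- Let $\zeta$ be the Riemann zeta function, let $\eta$ be the entire function given by $$\eta(z)=\tfrac12\,z(z-1)\,\pi^{-z/2}\,\Gamma(z/2)\,\zeta(z)$$ (extended through the removable singularities at $z=1$ and $z=0,-2,-4,\dots$), and let $\xi(z)=\eta(\tfrac12+iz)$, $z\in\mathbb{C}$. Let $\mathbb{P}_+$ be the set of continuous bounded positive-definite functions $f:\mathbb{R}\to\mathbb{C}$ with $f(0)=1$ (by Bochner's theorem, the characteristic functions of real-valued random variables). Let $\mathbb{LP}$ be the Laguerre–Pólya class, that is, the set of entire functions that are locally uniform limits on $\mathbb{C}$ of a sequence of polynomials with real coefficients and real zeros only. The Lukacs class $\mathbb{D}_L$ is the set of even functions $\varphi\in\mathbb{LP}$ with $\varphi(0)=1$ whose restriction to $\mathbb{R}$ belongs to $\mathbb{P}_+$. **Theorem.** The function $z\mapsto\xi(z)/\xi(0)$ belongs to $\mathbb{D}_L$ if and only if the Riemann hypothesis holds, i.e. if and only if every zero of $\zeta$ other than $-2,-4,-6,\dots$ has real part $\tfrac12$. -/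

import Mathlib

/-- The entire function `η` extending
`z ↦ (1/2) z (z - 1) π ^ (-z/2) Γ(z/2) ζ(z)`. The displayed formula is literally meaningless at the
poles `z = 1` of `ζ` and `z = 0, -2, -4, …` of `Γ(z/2)`. To have the correct values there too, `η` is
written with Mathlib's entire function `completedRiemannZeta₀`, which satisfies
`π ^ (-z/2) Γ(z/2) ζ(z) = completedRiemannZeta₀ z - 1 / z - 1 / (1 - z)`.
That `η` is this entire extension is proved in `riemannEta_eq` and `differentiable_riemannEta`. -/
noncomputable def riemannEta (z : ℂ) : ℂ :=
  (1 / 2) * (z * (z - 1) * completedRiemannZeta₀ z + 1)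

theorem differentiable_riemannEta : Differentiable ℂ riemannEta := by
  have h := differentiable_completedZeta₀
  unfold riemannEta
  fun_prop

theorem riemannEta_eq (z : ℂ) (h1 : z ≠ 1) (h2 : ∀ n : ℕ, z ≠ -2 * (n : ℂ)) :
    riemannEta z =
      (1 / 2) * z * (z - 1) * (Real.pi : ℂ) ^ (-z / 2) * Complex.Gamma (z / 2) *
        riemannZeta z := by
  have h0 : z ≠ 0 := by simpa using h2 0
  have hG : Complex.Gammaℝ z ≠ 0 := by
    rw [Ne, Complex.Gammaℝ_eq_zero_iff]
    rintro ⟨n, hn⟩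
    exact h2 n (by rw [hn]; ring)
  have h1' : 1 - z ≠ 0 := sub_ne_zero.mpr (Ne.symm h1)
  have hz := riemannZeta_def_of_ne_zero h0
  rw [eq_div_iff hG, completedRiemannZeta_eq] at hz
  have hG' : (Real.pi : ℂ) ^ (-z / 2) * Complex.Gamma (z / 2) = Complex.Gammaℝ z := by
    rw [Complex.Gammaℝ_def]
  have e : (1 / 2) * z * (z - 1) * (Real.pi : ℂ) ^ (-z / 2) * Complex.Gamma (z / 2) *
      riemannZeta z = (1 / 2) * z * (z - 1) * (riemannZeta z * Complex.Gammaℝ z) := by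
    rw [← hG']; ring
  rw [e, hz, riemannEta]
  field_simp
  ring

/-- The Riemann–Landau function `ξ(z) = η(1/2 + i z)`. -/
noncomputable def landauXi (z : ℂ) : ℂ :=
  riemannEta (1 / 2 + Complex.I * z)

/-- The Laguerre–Pólya class: the entire functions that are locally uniform limits of a sequence of
polynomials with real coefficients and real zeros only. -/
def LaguerrePolya : Set (ℂ → ℂ) :=
  {φ | Differentiable ℂ φ ∧
    ∃ p : ℕ → Polynomial ℝ,
      (∀ n, ∀ z : ℂ, Polynomial.aeval z (p n) = 0 → z.im = 0) ∧
      TendstoLocallyUniformly (fun n (z : ℂ) => Polynomial.aeval z (p n)) φ Filter.atTop}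

/-- The even functions in the Laguerre–Pólya class that are equal to `1` at the origin. -/
def EvenLaguerrePolya : Set (ℂ → ℂ) :=
  {φ | φ ∈ LaguerrePolya ∧ (∀ z, φ (-z) = φ z) ∧ φ 0 = 1}

open scoped ComplexOrder in
/-- The continuous bounded positive-definite functions on the real line, normalized to be `1` at the
origin (by Bochner's theorem, the characteristic functions of real random variables). The inequality
in `ℂ` says that the sum is a nonnegative real number. -/
def NormalizedPosDef : Set (ℝ → ℂ) :=
  {f | Continuous f ∧ (∃ C : ℝ, ∀ t, ‖f t‖ ≤ C) ∧
    (∀ (n : ℕ) (t : Fin n → ℝ) (c : Fin n → ℂ),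
      0 ≤ ∑ j, ∑ k, c j * (starRingEnd ℂ) (c k) * f (t j - t k)) ∧
    f 0 = 1}

/-- The Lukacs class: the even normalized Laguerre–Pólya functions whose restriction to the real
line is a characteristic function. -/
def LukacsClass : Set (ℂ → ℂ) :=
  {φ | φ ∈ EvenLaguerrePolya ∧ (fun t : ℝ => φ (t : ℂ)) ∈ NormalizedPosDef}

open Filter Topology Metric Set

/-! Positive definiteness of `ξ/ξ(0)` is unconditional; the Riemann hypothesis is exactly membership
in the Laguerre–Pólya class, because the zeros of `ξ` are the points `-i(s - 1/2)` with `s` a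
nontrivial zero of `ζ`.

Applying `2 d²/dx² - 1/8` to the even function `exp(x/4) θ(exp x)` produces a kernel `xiKernel` that
is positive, symmetric under `t ↦ 1/t` up to a power of `t`, and has Mellin transform `2η`. Hence
`ξ` on the real line is the Fourier integral of a positive integrable density (`landauXi_ofReal`),
and `sum_mul_integral_exp_nonneg` gives positive definiteness. The kernel beats every Gaussian in
`log t`, so `ξ(z) = O(exp(ε|z|²))` for every `ε > 0` (`exists_norm_landauXi_le`).

If all zeros are real, write `ξ(z)/ξ(0) = g(z²)`. Then `g` has exponential type zero, so it is the
limit of its products over zeros in growing discs, with no exponential factor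
(`exists_tendstoLocallyUniformly_prod_zeros`). Substituting `z²` gives real polynomials with real
zeros (`mem_laguerrePolya_of_even`). Conversely, a Hurwitz-type argument
(`LaguerrePolya.im_eq_zero`) forces the zeros of a Laguerre–Pólya function to be real. -/

/-! ### Entire functions of exponential type zero as limits of products over zeros. -/

theorem exists_exp_eq_of_ne_zero_on_ball {u : ℂ → ℂ} {R : ℝ} (hR : 0 < R)
    (hu : Differentiable ℂ u) (h0 : ∀ w ∈ ball (0 : ℂ) R, u w ≠ 0) (h1 : u 0 = 1) :
    ∃ h : ℂ → ℂ, DifferentiableOn ℂ h (ball 0 R) ∧ h 0 = 0 ∧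
      ∀ w ∈ ball (0 : ℂ) R, Complex.exp (h w) = u w := by
  have hu' : Differentiable ℂ (deriv u) := hu.contDiff.differentiable_deriv_two
  have hd : DifferentiableOn ℂ (fun w => deriv u w / u w) (ball 0 R) := fun w hw =>
    ((hu' w).div (hu w) (h0 w hw)).differentiableWithinAt
  obtain ⟨k, hk⟩ := hd.isExactOn_ball
  have hmem : (0 : ℂ) ∈ ball (0 : ℂ) R := mem_ball_self hR
  refine ⟨fun w => k w - k 0, fun w hw => ((hk w hw).differentiableAt.sub_const _).differentiableWithinAt,
    by simp, ?_⟩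
  have key : ∀ w ∈ ball (0 : ℂ) R, HasDerivAt (fun w => u w * Complex.exp (-(k w - k 0))) 0 w := by
    intro w hw
    refine ((hu w).hasDerivAt.mul (((hk w hw).sub_const (k 0)).neg.cexp)).congr_deriv ?_
    have hdiv : deriv u w / u w * u w = deriv u w := div_mul_cancel₀ _ (h0 w hw)
    show deriv u w * Complex.exp (-(k w - k 0)) +
      u w * (Complex.exp (-(k w - k 0)) * -(deriv u w / u w)) = 0
    linear_combination -Complex.exp (-(k w - k 0)) * hdiv
  have hconst : ∀ w ∈ ball (0 : ℂ) R, u w * Complex.exp (-(k w - k 0)) = 1 := by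
    intro w hw
    have := (convex_ball (0 : ℂ) R).is_const_of_fderivWithin_eq_zero (𝕜 := ℂ)
      (f := fun w => u w * Complex.exp (-(k w - k 0)))
      (fun x hx => (key x hx).differentiableAt.differentiableWithinAt)
      (fun x hx => by
        rw [fderivWithin_of_isOpen isOpen_ball hx]
        have := (key x hx).hasFDerivAt.fderiv
        rw [this]; ext; simp) hw hmem
    rw [this]; simp [h1]
  intro w hw
  have h2 := hconst w hw
  rw [Complex.exp_neg] at h2
  have h3 := Complex.exp_ne_zero (k w - k 0)
  field_simp at h2
  exact h2.symm

theorem exists_eq_pow_mul_of_differentiable {g : ℂ → ℂ} (hg : Differentiable ℂ g) (h0 : g 0 = 1)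
    {a : ℂ} (ha : a ≠ 0) :
    ∃ (m : ℕ) (v : ℂ → ℂ), Differentiable ℂ v ∧ v a ≠ 0 ∧ ∀ w, g w = (1 - w / a) ^ m * v w := by
  have hA : AnalyticOnNhd ℂ g univ := fun z _ => hg.analyticAt z
  have hne : ¬ ∀ᶠ z in 𝓝 a, g z = 0 := by
    intro h
    have := hA.eqOn_zero_of_preconnected_of_eventuallyEq_zero isPreconnected_univ (mem_univ a) h
    have := this (mem_univ 0)
    simp [h0] at this
  obtain ⟨m, G, hG, hGa, hgG⟩ := (hg.analyticAt a).exists_eventuallyEq_pow_smul_nonzero_iff.2 hne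
  -- The value at `a` is the limit of the quotient, since `(w - a)^m = (-a)^m (1 - w/a)^m`.
  refine ⟨m, Function.update (fun w => g w / (1 - w / a) ^ m) a ((-a) ^ m * G a), ?_, ?_, ?_⟩
  · intro w
    by_cases hw : w = a
    · subst hw
      have : (Function.update (fun z => g z / (1 - z / w) ^ m) w ((-w) ^ m * G w)) =ᶠ[𝓝 w]
          fun z => (-w) ^ m * G z := by
        filter_upwards [hgG] with z hz
        by_cases hzw : z = w
        · subst hzw; simp
        · rw [Function.update_of_ne hzw, hz]
          have h1 : z - w ≠ 0 := sub_ne_zero.2 hzw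
          have h2 : 1 - z / w = (z - w) / (-w) := by field_simp; ring
          have h3 : (-w) ≠ 0 := neg_ne_zero.2 ha
          rw [h2, div_pow, smul_eq_mul]
          field_simp
      exact (hG.differentiableAt.const_mul _).congr_of_eventuallyEq this
    · have : (Function.update (fun z => g z / (1 - z / a) ^ m) a ((-a) ^ m * G a)) =ᶠ[𝓝 w]
          fun z => g z / (1 - z / a) ^ m := by
        filter_upwards [isOpen_ne.mem_nhds hw] with z hz
        rw [Function.update_of_ne hz]
      refine DifferentiableAt.congr_of_eventuallyEq ?_ this
      refine (hg w).div (by fun_prop) (pow_ne_zero _ ?_)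
      rw [sub_ne_zero, ne_comm, Ne, div_eq_one_iff_eq ha]
      exact hw
  · simp [hGa, ha]
  · intro w
    by_cases hw : w = a
    · subst hw
      have := hgG.self_of_nhds
      rw [this]
      by_cases hm : m = 0
      · simp [hm]
      · simp [hm, ha]
    · rw [Function.update_of_ne hw]
      have : 1 - w / a ≠ 0 := by
        rw [sub_ne_zero, ne_comm, Ne, div_eq_one_iff_eq ha]
        exact hw
      field_simp

theorem exists_multiset_prod_mul {R : ℝ} {g : ℂ → ℂ} (hg : Differentiable ℂ g) (h0 : g 0 = 1) :
    ∃ (s : Multiset ℂ) (u : ℂ → ℂ), (∀ a ∈ s, g a = 0 ∧ ‖a‖ ≤ R) ∧ Differentiable ℂ u ∧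
      (∀ w, ‖w‖ ≤ R → u w ≠ 0) ∧ ∀ w, g w = (s.map fun a => 1 - w / a).prod * u w := by
  have hfin : {w | ‖w‖ ≤ R ∧ g w = 0}.Finite := by
    have hA : AnalyticOnNhd ℂ g univ := fun z _ => hg.analyticAt z
    by_contra hinf
    have hsub : {w | ‖w‖ ≤ R ∧ g w = 0} ⊆ closedBall 0 R := fun w hw => by simpa using hw.1
    obtain ⟨z, _, hz⟩ := Set.Infinite.exists_accPt_of_subset_isCompact
      hinf (isCompact_closedBall (0 : ℂ) R) hsub
    have hfr : ∃ᶠ w in 𝓝[≠] z, g w = 0 := by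
      rw [accPt_iff_frequently_nhdsNE] at hz
      exact hz.mono fun w hw => hw.2
    have := hA.eqOn_zero_of_preconnected_of_frequently_eq_zero isPreconnected_univ (mem_univ z) hfr
      (mem_univ 0)
    simp [h0] at this
  obtain ⟨Z, hZ⟩ := hfin.exists_finset
  -- Only this inclusion is kept: it survives dividing out a zero, so the induction on `Z` can vary
  -- `g`. Points of `Z` that are not zeros are simply skipped.
  have hZ' : ∀ w, ‖w‖ ≤ R → g w = 0 → w ∈ Z := fun w h1 h2 => (hZ w).2 ⟨h1, h2⟩
  clear hZ hfin
  induction Z using Finset.induction_on generalizing g with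
  | empty => exact ⟨0, g, by simp, hg, fun w hw h => by simpa using hZ' w hw h, by simp⟩
  | insert a Z haZ ih =>
    by_cases ha : ‖a‖ ≤ R ∧ g a = 0
    · have ha0 : a ≠ 0 := by rintro rfl; simp [h0] at ha
      obtain ⟨m, v, hv, hva, hgv⟩ := exists_eq_pow_mul_of_differentiable hg h0 ha0
      have hv0 : v 0 = 1 := by have := hgv 0; simpa [h0] using this.symm
      obtain ⟨s, u, hs, hu, hu0, hvu⟩ := ih hv hv0 (by
        intro w h1 h2
        have := hZ' w h1 (by rw [hgv, h2, mul_zero])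
        rcases Finset.mem_insert.1 this with rfl | h
        · exact absurd h2 hva
        · exact h)
      refine ⟨Multiset.replicate m a + s, u, ?_, hu, hu0, ?_⟩
      · intro b hb
        rcases Multiset.mem_add.1 hb with hb | hb
        · rw [Multiset.eq_of_mem_replicate hb]; exact ⟨ha.2, ha.1⟩
        · exact ⟨by rw [hgv, (hs b hb).1, mul_zero], (hs b hb).2⟩
      · intro w
        rw [hgv, hvu]
        simp [mul_assoc]
    · refine ih hg h0 fun w h1 h2 => ?_
      rcases Finset.mem_insert.1 (hZ' w h1 h2) with rfl | h
      · exact absurd ⟨h1, h2⟩ ha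
      · exact h

theorem one_le_norm_multiset_prod {s : Multiset ℂ} {R : ℝ} (hs : ∀ a ∈ s, a ≠ 0 ∧ ‖a‖ ≤ R)
    {w : ℂ} (hw : 2 * R ≤ ‖w‖) : 1 ≤ ‖(s.map fun a => 1 - w / a).prod‖ := by
  induction s using Multiset.induction_on with
  | empty => simp
  | cons a s ih =>
    rw [Multiset.map_cons, Multiset.prod_cons, norm_mul]
    have h1 := ih fun b hb => hs b (Multiset.mem_cons_of_mem hb)
    obtain ⟨ha, haR⟩ := hs a (Multiset.mem_cons_self a s)
    have h2 : 2 ≤ ‖w / a‖ := by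
      rw [norm_div, le_div_iff₀ (norm_pos_iff.2 ha)]
      linarith
    have h3 : 1 ≤ ‖1 - w / a‖ := by
      have := norm_sub_norm_le (w / a) 1
      rw [norm_sub_rev] at this
      simp only [norm_one] at this
      linarith
    nlinarith

/-- On the circle of radius `2R` every factor satisfies `|1 - w/a| ≥ 1`, so there `|u| ≤ |g|`; the
maximum principle carries the bound inside. As `u` has no zeros in the disc of radius `R`, it has a
logarithm there with real part at most `log C + 2εR`, and Borel–Carathéodory bounds its modulus. The
constants use `R - r ≥ R/2`. -/
theorem norm_log_cofactor_le {g : ℂ → ℂ} (h0 : g 0 = 1) {ε C R r : ℝ}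
    (hε : 0 < ε) (hC : 1 ≤ C) (hb : ∀ w, ‖g w‖ ≤ C * Real.exp (ε * ‖w‖)) (hr : 0 ≤ r)
    (hR : 0 < R) (hrR : 2 * r < R) {s : Multiset ℂ} {u : ℂ → ℂ} (hs : ∀ a ∈ s, g a = 0 ∧ ‖a‖ ≤ R)
    (hu : Differentiable ℂ u) (hu0 : ∀ w, ‖w‖ ≤ R → u w ≠ 0)
    (hgu : ∀ w, g w = (s.map fun a => 1 - w / a).prod * u w) {w : ℂ} (hw : ‖w‖ ≤ r) :
    ∃ l : ℂ, ‖l‖ ≤ 4 * r * Real.log C / R + 8 * r * ε ∧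
      (s.map fun a => 1 - w / a).prod = g w * Complex.exp l := by
  have hs' : ∀ a ∈ s, a ≠ 0 ∧ ‖a‖ ≤ R := fun a ha =>
    ⟨by rintro rfl; simpa [h0] using (hs _ ha).1, (hs a ha).2⟩
  have hub : ∀ z ∈ ball (0 : ℂ) R, ‖u z‖ ≤ C * Real.exp (ε * (2 * R)) := by
    intro z hz
    have hz' : z ∈ closure (ball (0 : ℂ) (2 * R)) :=
      subset_closure (ball_subset_ball (by linarith) hz)
    refine Complex.norm_le_of_forall_mem_frontier_norm_le isBounded_ball hu.diffContOnCl
      (fun y hy => ?_) hz'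
    rw [frontier_ball _ (by positivity)] at hy
    have hy' : ‖y‖ = 2 * R := by simpa using hy
    have h1 := one_le_norm_multiset_prod hs' hy'.ge
    have h2 := hb y
    rw [hgu, norm_mul, hy'] at h2
    nlinarith [norm_nonneg (u y)]
  have hu1 : u 0 = 1 := by have := hgu 0; simpa [h0] using this.symm
  obtain ⟨h, hh, hh0, hexp⟩ := exists_exp_eq_of_ne_zero_on_ball hR hu
    (fun w hw => hu0 w (by simpa using (mem_ball.1 hw).le)) hu1
  have hM : 0 < Real.log C + ε * (2 * R) := by
    have := Real.log_nonneg hC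
    positivity
  have hmaps : MapsTo h (ball 0 R) {z | z.re ≤ Real.log C + ε * (2 * R)} := by
    intro z hz
    have h1 := hub z hz
    rw [← hexp z hz, Complex.norm_exp, ← Real.exp_log (by linarith : 0 < C), ← Real.exp_add,
      Real.exp_le_exp] at h1
    exact h1
  have hwR : w ∈ ball (0 : ℂ) R := by
    simp only [mem_ball, dist_zero_right]; linarith
  have hB := Complex.borelCaratheodory_zero hM hh hmaps hR hwR hh0
  refine ⟨-h w, ?_, ?_⟩
  · rw [norm_neg]
    refine hB.trans ?_
    have : 4 * r * Real.log C / R + 8 * r * ε =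
      2 * (Real.log C + ε * (2 * R)) * r / (R / 2) := by field_simp; ring
    rw [this]
    gcongr
    linarith
  · rw [hgu, ← hexp w hwR, mul_assoc, ← Complex.exp_add]
    simp

/-- An entire function of exponential type zero is the locally uniform limit of the products over
its zeros in balls of increasing radius. -/
theorem exists_tendstoLocallyUniformly_prod_zeros {g : ℂ → ℂ} (hg : Differentiable ℂ g)
    (h0 : g 0 = 1) (hb : ∀ ε > 0, ∃ C : ℝ, ∀ w, ‖g w‖ ≤ C * Real.exp (ε * ‖w‖)) :
    ∃ s : ℕ → Multiset ℂ, (∀ n, ∀ a ∈ s n, g a = 0) ∧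
      TendstoLocallyUniformly (fun n w => ((s n).map fun a => 1 - w / a).prod) g atTop := by
  choose s u hs hu hu0 hgu using
    fun n : ℕ => exists_multiset_prod_mul (R := (n : ℝ) + 1) hg h0
  refine ⟨s, fun n a ha => (hs n a ha).1, ?_⟩
  rw [← tendstoLocallyUniformlyOn_univ, tendstoLocallyUniformlyOn_iff_forall_isCompact isOpen_univ]
  intro K _ hK
  obtain ⟨r, hr, hKr⟩ : ∃ r : ℝ, 0 < r ∧ ∀ w ∈ K, ‖w‖ ≤ r := by
    obtain ⟨r, hr⟩ := hK.isBounded.exists_norm_le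
    exact ⟨max r 1, by positivity, fun w hw => (hr w hw).trans (le_max_left _ _)⟩
  obtain ⟨B, hB⟩ := hK.exists_bound_of_continuousOn hg.continuous.continuousOn
  rw [Metric.tendstoUniformlyOn_iff]
  intro δ hδ
  obtain ⟨κ, hκ, hκ1, hκδ⟩ : ∃ κ : ℝ, 0 < κ ∧ κ ≤ 1 ∧ |B| * (2 * κ) < δ := by
    refine ⟨min 1 (δ / (4 * (|B| + 1))), by positivity, min_le_left _ _, ?_⟩
    have h1 : min 1 (δ / (4 * (|B| + 1))) ≤ δ / (4 * (|B| + 1)) := min_le_right _ _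
    have h2 : |B| * (2 * (δ / (4 * (|B| + 1)))) < δ := by
      have : |B| * (2 * (δ / (4 * (|B| + 1)))) = δ * (|B| / (2 * (|B| + 1))) := by
        field_simp; ring
      rw [this]
      have : |B| / (2 * (|B| + 1)) < 1 := by
        rw [div_lt_one (by positivity)]; linarith [abs_nonneg B]
      nlinarith
    exact lt_of_le_of_lt (by gcongr) h2
  -- With this `ε` the term `8rε`, which does not decay with the radius, is `κ/2`.
  obtain ⟨C, hC⟩ := hb (κ / (16 * r)) (by positivity)
  have hC1 : 1 ≤ C := by have := hC 0; simpa [h0] using this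
  have hlim : Tendsto (fun n : ℕ => 4 * r * Real.log C / ((n : ℝ) + 1)) atTop (𝓝 0) :=
    tendsto_const_nhds.div_atTop (tendsto_natCast_atTop_atTop.atTop_add tendsto_const_nhds)
  filter_upwards [hlim.eventually (gt_mem_nhds (half_pos hκ)),
    (tendsto_natCast_atTop_atTop (R := ℝ)).eventually (eventually_ge_atTop (2 * r))]
    with n hn1 hn2 w hw
  obtain ⟨l, hl, hprod⟩ := norm_log_cofactor_le h0 (by positivity : 0 < κ / (16 * r)) hC1 hC
    hr.le (by positivity : (0 : ℝ) < n + 1) (by linarith) (hs n) (hu n) (hu0 n) (hgu n) (hKr w hw)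
  have hlκ : ‖l‖ ≤ κ := by
    have : 8 * r * (κ / (16 * r)) = κ / 2 := by field_simp; norm_num
    rw [this] at hl
    linarith
  rw [hprod, dist_comm, dist_eq_norm]
  have : g w * Complex.exp l - g w = g w * (Complex.exp l - 1) := by ring
  rw [this, norm_mul]
  have h1 := Complex.norm_exp_sub_one_le (hlκ.trans hκ1)
  calc ‖g w‖ * ‖Complex.exp l - 1‖ ≤ |B| * (2 * κ) := by
        gcongr
        · exact (hB w hw).trans (le_abs_self B)
        · linarith
    _ < δ := hκδ

/-! ### Even entire functions, and zeros of Laguerre–Pólya functions. -/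

/-- Evenness makes `f(√w)` independent of the branch of the root. Near `w ≠ 0` the branch `√w ·
√(z/w)` is holomorphic, as `z/w` is close to `1`; at `0` continuity makes the singularity removable.
-/
theorem exists_differentiable_comp_sq {f : ℂ → ℂ} (hf : Differentiable ℂ f)
    (heven : ∀ z, f (-z) = f z) : ∃ g : ℂ → ℂ, Differentiable ℂ g ∧ ∀ z, g (z ^ 2) = f z := by
  have hsq : ∀ a b : ℂ, a ^ 2 = b ^ 2 → f a = f b := by
    intro a b h
    rcases sq_eq_sq_iff_eq_or_eq_neg.1 h with rfl | rfl
    · rfl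
    · exact heven b
  have hroot : ∀ w : ℂ, (w ^ (1 / 2 : ℂ)) ^ 2 = w := by
    intro w
    simp [← Complex.cpow_nat_mul]
  refine ⟨fun w => f (w ^ (1 / 2 : ℂ)), ?_, fun z => hsq _ _ (hroot _)⟩
  have hne : ∀ w : ℂ, w ≠ 0 → DifferentiableAt ℂ (fun w => f (w ^ (1 / 2 : ℂ))) w := by
    intro w hw
    have h1 : (fun z => f (z ^ (1 / 2 : ℂ))) =
        fun z => f (w ^ (1 / 2 : ℂ) * (z / w) ^ (1 / 2 : ℂ)) := by
      funext z
      apply hsq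
      rw [mul_pow, hroot, hroot, hroot]
      field_simp
    rw [h1]
    refine (hf _).comp w (DifferentiableAt.const_mul ?_ _)
    refine DifferentiableAt.cpow (by fun_prop) (by fun_prop) ?_
    simp [hw]
  have hcont : ContinuousAt (fun w => f (w ^ (1 / 2 : ℂ))) 0 := by
    refine ContinuousAt.comp (hf _).continuousAt ?_
    exact Complex.continuousAt_cpow_const_of_re_pos (by simp) (by norm_num)
  intro w
  have := (Complex.differentiableOn_compl_singleton_and_continuousAt_iff
    (s := univ) (c := (0 : ℂ)) univ_mem).1 ⟨fun z hz => (hne z (by simpa using hz)).differentiableWithinAt, hcont⟩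
  exact (this w (mem_univ w)).differentiableAt univ_mem

/-- On a small disc about a nonreal zero, avoiding the real axis, the polynomials have no zeros, so
the maximum principle for `1/p_n` keeps `|p_n|` at the centre at least half the minimum of `|φ|` on
the circle, against `p_n(z) → 0`. The condition at `0` excludes the limit `φ = 0`. -/
theorem LaguerrePolya.im_eq_zero {φ : ℂ → ℂ} (hφ : φ ∈ LaguerrePolya) (h0 : φ 0 ≠ 0) {z : ℂ}
    (hz : φ z = 0) : z.im = 0 := by
  obtain ⟨hd, p, hp, hlim⟩ := hφ
  by_contra him
  have hA : AnalyticOnNhd ℂ φ univ := fun z _ => hd.analyticAt z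
  have hiso : ∀ᶠ w in 𝓝[≠] z, φ w ≠ 0 := by
    rcases (hd.analyticAt z).eventually_eq_zero_or_eventually_ne_zero with h | h
    · exact absurd (hA.eqOn_zero_of_preconnected_of_eventuallyEq_zero isPreconnected_univ
        (mem_univ z) h (mem_univ 0)) h0
    · exact h
  have him' : ∀ᶠ w in 𝓝 z, w.im ≠ 0 :=
    (Complex.continuous_im.continuousAt).eventually_ne him
  obtain ⟨r, hr, hball⟩ := Metric.eventually_nhds_iff_ball.1
    ((eventually_nhdsWithin_iff.1 hiso).and him')
  set ρ := r / 2 with hρ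
  have hρ0 : 0 < ρ := by positivity
  have hsub : closedBall z ρ ⊆ ball z r := closedBall_subset_ball (by linarith)
  obtain ⟨y, hy, hymin⟩ := (isCompact_sphere z ρ).exists_isMinOn
    (NormedSpace.sphere_nonempty.2 hρ0.le) (hd.continuous.norm.continuousOn)
  have hm : 0 < ‖φ y‖ := norm_pos_iff.2 ((hball y (hsub (sphere_subset_closedBall hy))).1 (by
    rintro rfl; simp at hy; linarith))
  set m := ‖φ y‖
  have hunif : TendstoUniformlyOn (fun n (z : ℂ) => Polynomial.aeval z (p n)) φ atTop
      (closedBall z ρ) :=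
    (tendstoLocallyUniformlyOn_iff_forall_isCompact isOpen_univ).1
      (tendstoLocallyUniformlyOn_univ.2 hlim) _ (subset_univ _) (isCompact_closedBall z ρ)
  obtain ⟨n, hn⟩ := (Metric.tendstoUniformlyOn_iff.1 hunif (m / 2) (by positivity)).exists
  have hne : ∀ w ∈ closedBall z ρ, Polynomial.aeval w (p n) ≠ 0 := fun w hw h =>
    (hball w (hsub hw)).2 (hp n w h)
  have hdp : Differentiable ℂ (fun w : ℂ => Polynomial.aeval w (p n)) :=
    (p n).differentiable_aeval
  have hinv : DiffContOnCl ℂ (fun w : ℂ => (Polynomial.aeval w (p n))⁻¹) (ball z ρ) := by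
    refine DiffContOnCl.inv hdp.diffContOnCl fun w hw => hne w ?_
    rwa [closure_ball z hρ0.ne'] at hw
  have hle := Complex.norm_le_of_forall_mem_frontier_norm_le (C := 2 / m) isBounded_ball hinv
    (fun w hw => by
      rw [frontier_ball z hρ0.ne'] at hw
      have h1 := hn w (sphere_subset_closedBall hw)
      have h2 : m ≤ ‖φ w‖ := hymin hw
      rw [dist_eq_norm] at h1
      have h3 := norm_sub_norm_le (φ w) (Polynomial.aeval w (p n))
      rw [norm_inv, show 2 / m = (m / 2)⁻¹ by rw [inv_div]]
      gcongr
      linarith) (subset_closure (mem_ball_self hρ0))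
  have h1 := hn z (mem_closedBall_self hρ0.le)
  rw [hz, dist_zero_left] at h1
  have h2 : 0 < ‖Polynomial.aeval z (p n)‖ := norm_pos_iff.2 (hne z (mem_closedBall_self hρ0.le))
  rw [norm_inv, inv_le_comm₀ h2 (by positivity), inv_div] at hle
  linarith

/-! ### Theta series: derivatives and bounds. -/

/-- The series `∑ m ^ (2k) exp (-π m² t)` over the positive integers `m`. -/
noncomputable def thetaMoment (k : ℕ) (t : ℝ) : ℝ :=
  ∑' n : ℕ, ((n : ℝ) + 1) ^ (2 * k) * Real.exp (-Real.pi * ((n : ℝ) + 1) ^ 2 * t)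

theorem summable_succ_pow_mul_exp_neg (k : ℕ) {r : ℝ} (hr : 0 < r) :
    Summable fun n : ℕ => ((n : ℝ) + 1) ^ k * Real.exp (-r * ((n : ℝ) + 1)) := by
  have := (summable_nat_add_iff 1).2 (Real.summable_pow_mul_exp_neg_nat_mul k hr)
  simpa using this

theorem exp_neg_pi_succ_sq_le {δ t : ℝ} (hδ : 0 < δ) (ht : δ ≤ t) (n : ℕ) :
    Real.exp (-Real.pi * ((n : ℝ) + 1) ^ 2 * t) ≤ Real.exp (-(Real.pi * δ) * ((n : ℝ) + 1)) := by
  rw [Real.exp_le_exp]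
  have hn : (0 : ℝ) ≤ n := n.cast_nonneg
  have h1 : (n : ℝ) + 1 ≤ ((n : ℝ) + 1) ^ 2 := by nlinarith
  have ht0 : 0 ≤ t := hδ.le.trans ht
  have h2 : δ * ((n : ℝ) + 1) ≤ t * ((n : ℝ) + 1) ^ 2 := by gcongr
  nlinarith [Real.pi_pos]

theorem summable_thetaMoment (k : ℕ) {t : ℝ} (ht : 0 < t) :
    Summable fun n : ℕ =>
      ((n : ℝ) + 1) ^ (2 * k) * Real.exp (-Real.pi * ((n : ℝ) + 1) ^ 2 * t) := by
  refine (summable_succ_pow_mul_exp_neg (2 * k) (mul_pos Real.pi_pos ht)).of_nonneg_of_le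
    (fun n => by positivity) fun n => ?_
  gcongr ?_ * ?_
  exact exp_neg_pi_succ_sq_le ht le_rfl n

theorem hasDerivAt_thetaMoment (k : ℕ) {t : ℝ} (ht : 0 < t) :
    HasDerivAt (thetaMoment k) (-Real.pi * thetaMoment (k + 1) t) t := by
  have hmem : t ∈ Ioi (t / 2) := by simp [ht]
  have h := hasDerivAt_tsum_of_isPreconnected
    (g := fun (n : ℕ) (t : ℝ) =>
      ((n : ℝ) + 1) ^ (2 * k) * Real.exp (-Real.pi * ((n : ℝ) + 1) ^ 2 * t))
    (g' := fun (n : ℕ) (t : ℝ) =>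
      -Real.pi * (((n : ℝ) + 1) ^ (2 * (k + 1)) * Real.exp (-Real.pi * ((n : ℝ) + 1) ^ 2 * t)))
    ((summable_succ_pow_mul_exp_neg (2 * (k + 1))
      (mul_pos Real.pi_pos (half_pos ht))).mul_left Real.pi)
    isOpen_Ioi isPreconnected_Ioi
    (fun n y _ => by
      have h1 : HasDerivAt (fun y : ℝ => -Real.pi * ((n : ℝ) + 1) ^ 2 * y)
          (-Real.pi * ((n : ℝ) + 1) ^ 2) y := by
        simpa only [id, mul_one] using (hasDerivAt_id y).const_mul (-Real.pi * ((n : ℝ) + 1) ^ 2)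
      exact (h1.exp.const_mul (((n : ℝ) + 1) ^ (2 * k))).congr_deriv (by ring))
    (fun n y hy => by
      rw [norm_mul, norm_neg, Real.norm_of_nonneg Real.pi_pos.le, Real.norm_of_nonneg (by positivity)]
      gcongr ?_ * (?_ * ?_)
      exact exp_neg_pi_succ_sq_le (half_pos ht) (le_of_lt hy) n)
    hmem (summable_thetaMoment k ht) hmem
  rw [tsum_mul_left] at h
  exact h

theorem thetaMoment_pos (k : ℕ) {t : ℝ} (ht : 0 < t) : 0 < thetaMoment k t :=
  (summable_thetaMoment k ht).tsum_pos (fun n => by positivity) 0 (by positivity)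

theorem thetaMoment_le_succ (k : ℕ) {t : ℝ} (ht : 0 < t) :
    thetaMoment k t ≤ thetaMoment (k + 1) t := by
  refine (summable_thetaMoment k ht).tsum_le_tsum (fun n => ?_) (summable_thetaMoment (k + 1) ht)
  have : (1 : ℝ) ≤ n + 1 := by linarith [n.cast_nonneg (α := ℝ)]
  gcongr ?_ * _
  exact pow_le_pow_right₀ this (by omega)

/-- As `π > 3`, one share of `m²t` in the exponent pays for summability and two pay for the decay in
`t`. -/
theorem exists_thetaMoment_le_exp (k : ℕ) :
    ∃ C : ℝ, 0 < C ∧ ∀ t : ℝ, 1 ≤ t → thetaMoment k t ≤ C * Real.exp (-2 * t) := by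
  have hs := summable_succ_pow_mul_exp_neg (2 * k) one_pos
  refine ⟨_, hs.tsum_pos (fun n => by positivity) 0 (by positivity), fun t ht => ?_⟩
  rw [← tsum_mul_right]
  refine (summable_thetaMoment k (by linarith)).tsum_le_tsum (fun n => ?_) (hs.mul_right _)
  rw [mul_assoc _ (Real.exp _), ← Real.exp_add]
  gcongr
  have hn : (0 : ℝ) ≤ n := n.cast_nonneg
  have h1 : (n : ℝ) + 1 ≤ ((n : ℝ) + 1) ^ 2 := by nlinarith
  have h2 : (n : ℝ) + 1 ≤ ((n : ℝ) + 1) ^ 2 * t := by nlinarith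
  have h3 : t ≤ ((n : ℝ) + 1) ^ 2 * t := by nlinarith
  nlinarith [Real.pi_gt_three]

/-- From `y^(k+1)/(k+1)! ≤ exp y` at `y = m²t`, which leaves the convergent `∑ m⁻²`. -/
theorem exists_thetaMoment_le_inv_pow (k : ℕ) :
    ∃ C : ℝ, ∀ t : ℝ, 0 < t → thetaMoment k t ≤ C * (t ^ (k + 1))⁻¹ := by
  have hs : Summable fun n : ℕ => ((k + 1).factorial : ℝ) * (((n : ℝ) + 1) ^ 2)⁻¹ := by
    have := (summable_nat_add_iff 1).2 (Real.summable_nat_pow_inv.2 (by norm_num : 1 < 2))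
    simpa using this.mul_left ((k + 1).factorial : ℝ)
  refine ⟨∑' n : ℕ, ((k + 1).factorial : ℝ) * (((n : ℝ) + 1) ^ 2)⁻¹, fun t ht => ?_⟩
  rw [← tsum_mul_right]
  refine (summable_thetaMoment k ht).tsum_le_tsum (fun n => ?_) (hs.mul_right _)
  set m : ℝ := (n : ℝ) + 1 with hm
  have hm0 : 0 < m := by positivity
  have h1 := Real.pow_div_factorial_le_exp (m ^ 2 * t) (by positivity) (k + 1)
  have h2 : Real.exp (m ^ 2 * t) ≤ Real.exp (Real.pi * m ^ 2 * t) := by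
    rw [Real.exp_le_exp]
    have : 0 < m ^ 2 * t := by positivity
    nlinarith [Real.pi_gt_three]
  have h3 := h1.trans h2
  rw [show -Real.pi * m ^ 2 * t = -(Real.pi * m ^ 2 * t) by ring, Real.exp_neg]
  have h4 : (0 : ℝ) < (k + 1).factorial := by positivity
  rw [div_le_iff₀ h4] at h3
  have h5 := Real.exp_pos (Real.pi * m ^ 2 * t)
  rw [← div_eq_mul_inv, div_le_iff₀ h5]
  have : m ^ (2 * k) = (m ^ 2)⁻¹ * (t ^ (k + 1))⁻¹ * (m ^ 2 * t) ^ (k + 1) := by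
    rw [mul_pow, pow_mul, pow_succ (m ^ 2)]
    field_simp
  rw [this]
  calc (m ^ 2)⁻¹ * (t ^ (k + 1))⁻¹ * (m ^ 2 * t) ^ (k + 1)
      ≤ (m ^ 2)⁻¹ * (t ^ (k + 1))⁻¹ * (Real.exp (Real.pi * m ^ 2 * t) * (k + 1).factorial) := by
        gcongr
    _ = _ := by ring

/-! ### Jacobi inversion and the positive symmetric kernel. -/

theorem tsum_int_exp_neg_pi_sq {t : ℝ} (ht : 0 < t) :
    ∑' n : ℤ, Real.exp (-Real.pi * t * (n : ℝ) ^ 2) = 1 + 2 * thetaMoment 0 t := by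
  have h := (summable_thetaMoment 0 ht).hasSum
  simp only [mul_zero, pow_zero, one_mul] at h
  have h0 : thetaMoment 0 t = ∑' n : ℕ, Real.exp (-Real.pi * ((n : ℝ) + 1) ^ 2 * t) := by
    simp [thetaMoment]
  rw [← h0] at h
  have h1 : HasSum (fun n : ℕ => Real.exp (-Real.pi * t * ((n : ℤ) : ℝ) ^ 2))
      (1 + thetaMoment 0 t) := by
    have : HasSum (fun n : ℕ => Real.exp (-Real.pi * t * (((n + 1 : ℕ) : ℤ) : ℝ) ^ 2))
        (thetaMoment 0 t) := by
      refine h.congr_fun fun n => ?_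
      push_cast
      ring_nf
    have h3 := HasSum.zero_add (f := fun n : ℕ => Real.exp (-Real.pi * t * ((n : ℤ) : ℝ) ^ 2)) this
    simpa using h3
  have h2 : HasSum (fun n : ℕ => Real.exp (-Real.pi * t * ((-((n : ℤ) + 1) : ℤ) : ℝ) ^ 2))
      (thetaMoment 0 t) := by
    refine h.congr_fun fun n => ?_
    push_cast
    ring_nf
  rw [(HasSum.of_nat_of_neg_add_one (f := fun n : ℤ => Real.exp (-Real.pi * t * (n : ℝ) ^ 2))
    h1 h2).tsum_eq]
  ring

/-- The theta function in logarithmic coordinates, normalized so as to be even. -/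
noncomputable def logTheta (x : ℝ) : ℝ :=
  Real.exp (x / 4) * (1 + 2 * thetaMoment 0 (Real.exp x))

theorem logTheta_neg (x : ℝ) : logTheta (-x) = logTheta x := by
  have h := Real.tsum_exp_neg_mul_int_sq (Real.exp_pos x)
  rw [tsum_int_exp_neg_pi_sq (Real.exp_pos x), show -Real.pi / Real.exp x = -Real.pi * Real.exp (-x) by
    rw [Real.exp_neg, div_eq_mul_inv], tsum_int_exp_neg_pi_sq (Real.exp_pos (-x)),
    ← Real.exp_mul, one_div, ← Real.exp_neg] at h
  rw [logTheta, logTheta, h, ← mul_assoc, ← Real.exp_add]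
  ring_nf

/-- The kernel whose Mellin transform is `2 η`. -/
noncomputable def xiKernel (t : ℝ) : ℝ :=
  4 * Real.pi ^ 2 * t ^ 2 * thetaMoment 2 t - 6 * Real.pi * t * thetaMoment 1 t

theorem hasDerivAt_thetaMoment_exp (k : ℕ) (x : ℝ) :
    HasDerivAt (fun x => thetaMoment k (Real.exp x))
      (-Real.pi * thetaMoment (k + 1) (Real.exp x) * Real.exp x) x :=
  (hasDerivAt_thetaMoment k (Real.exp_pos x)).comp x (Real.hasDerivAt_exp x)

theorem hasDerivAt_exp_div_four (x : ℝ) :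
    HasDerivAt (fun x : ℝ => Real.exp (x / 4)) (Real.exp (x / 4) * (1 / 4)) x :=
  ((hasDerivAt_id x).div_const 4).exp

/-- The operator `2 d²/dx² - 1/8` annihilates `exp(x/4)`, so the constant term of the theta series,
which spoils decay, drops out, while evenness survives. -/
theorem exp_mul_xiKernel_eq (x : ℝ) :
    Real.exp (x / 4) * xiKernel (Real.exp x) = 2 * deriv (deriv logTheta) x - logTheta x / 8 := by
  have h1 : ∀ x, HasDerivAt logTheta (Real.exp (x / 4) * ((1 + 2 * thetaMoment 0 (Real.exp x)) / 4 -
      2 * Real.pi * (Real.exp x * thetaMoment 1 (Real.exp x)))) x := by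
    intro x
    refine ((hasDerivAt_exp_div_four x).mul
      (((hasDerivAt_thetaMoment_exp 0 x).const_mul 2).const_add 1)).congr_deriv ?_
    simp only [zero_add]
    ring
  have h2 := (hasDerivAt_exp_div_four x).mul
    (((((hasDerivAt_thetaMoment_exp 0 x).const_mul 2).const_add 1).div_const 4).sub
      (((Real.hasDerivAt_exp x).mul (hasDerivAt_thetaMoment_exp 1 x)).const_mul (2 * Real.pi)))
  rw [show deriv logTheta = _ from funext fun x => (h1 x).deriv]
  have h3 := h2.deriv
  simp only [Pi.mul_def, Pi.sub_def] at h3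
  rw [h3, xiKernel, logTheta]
  simp only [zero_add, Nat.reduceAdd]
  ring

theorem exp_mul_xiKernel_neg (x : ℝ) :
    Real.exp (-x / 4) * xiKernel (Real.exp (-x)) = Real.exp (x / 4) * xiKernel (Real.exp x) := by
  have he : (fun x => logTheta (-x)) = logTheta := funext logTheta_neg
  have h1 : ∀ y, deriv logTheta (-y) = -deriv logTheta y := fun y => by
    have := deriv_comp_neg logTheta y
    rw [he] at this
    linarith
  have h2 : deriv (deriv logTheta) (-x) = deriv (deriv logTheta) x := by
    have := deriv_comp_neg (deriv logTheta) x
    rw [show (fun x => deriv logTheta (-x)) = fun x => -deriv logTheta x from funext h1,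
      deriv.fun_neg] at this
    linarith
  rw [exp_mul_xiKernel_eq, exp_mul_xiKernel_eq, h2, logTheta_neg]

theorem xiKernel_exp_neg (x : ℝ) :
    xiKernel (Real.exp (-x)) = Real.exp (x / 2) * xiKernel (Real.exp x) := by
  have h := exp_mul_xiKernel_neg x
  have h1 : Real.exp (-x / 4) * Real.exp (x / 4) = 1 := by
    rw [← Real.exp_add, ← Real.exp_zero]; congr 1; ring
  have h2 : Real.exp (x / 2) = Real.exp (x / 4) * Real.exp (x / 4) := by
    rw [← Real.exp_add]; congr 1; ring
  rw [h2]
  linear_combination Real.exp (x / 4) * h - xiKernel (Real.exp (-x)) * h1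

/-- For `t ≥ 1`, `thetaMoment 1 ≤ thetaMoment 2` and `2πt > 3`; inversion `t ↦ 1/t` covers `t < 1`.
-/
theorem xiKernel_pos {t : ℝ} (ht : 0 < t) : 0 < xiKernel t := by
  have h1 : ∀ t : ℝ, 1 ≤ t → 0 < xiKernel t := by
    intro t ht
    have ht0 : 0 < t := by linarith
    have ha := thetaMoment_pos 1 ht0
    have hb := thetaMoment_le_succ 1 ht0
    have hpi := Real.pi_gt_three
    have hc : 4 * Real.pi ^ 2 * t ^ 2 * thetaMoment 1 t ≤ 4 * Real.pi ^ 2 * t ^ 2 * thetaMoment 2 t := by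
      gcongr
    have hd : 0 < 2 * Real.pi * t * thetaMoment 1 t * (2 * (Real.pi * t) - 3) := by
      have : 0 < 2 * (Real.pi * t) - 3 := by nlinarith
      positivity
    rw [xiKernel]
    linarith [hc, hd]
  rcases le_total 1 t with h | h
  · exact h1 t h
  · have h2 := xiKernel_exp_neg (-Real.log t)
    rw [neg_neg, Real.exp_log ht] at h2
    rw [h2]
    refine mul_pos (Real.exp_pos _) (h1 _ ?_)
    rw [Real.one_le_exp_iff]
    linarith [Real.log_nonpos ht.le h]

theorem exists_xiKernel_exp_mul_le (A : ℝ) :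
    ∃ C : ℝ, ∀ x : ℝ, xiKernel (Real.exp x) * Real.exp (A * x ^ 2) ≤ C := by
  obtain ⟨C, hC, hle⟩ := exists_thetaMoment_le_exp 2
  set c : ℝ := |A| + 2 with hc
  have hc0 : 0 < c := by positivity
  have hpos : ∀ x : ℝ, 0 ≤ x →
      xiKernel (Real.exp x) * Real.exp ((A + 1) * x ^ 2) ≤
        4 * Real.pi ^ 2 * C * Real.exp (1 + 9 * c ^ 3) := by
    intro x hx
    have h1 : 1 ≤ Real.exp x := Real.one_le_exp hx
    have h2 : xiKernel (Real.exp x) ≤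
        4 * Real.pi ^ 2 * C * (Real.exp (2 * x) * Real.exp (-2 * Real.exp x)) := by
      have ha : 0 < 6 * Real.pi * Real.exp x * thetaMoment 1 (Real.exp x) := by
        have := thetaMoment_pos 1 (Real.exp_pos x)
        positivity
      have hb := hle _ h1
      calc xiKernel (Real.exp x) ≤ 4 * Real.pi ^ 2 * Real.exp x ^ 2 * thetaMoment 2 (Real.exp x) := by
            rw [xiKernel]; linarith
        _ ≤ 4 * Real.pi ^ 2 * Real.exp x ^ 2 * (C * Real.exp (-2 * Real.exp x)) := by gcongr
        _ = _ := by
            rw [show Real.exp (2 * x) = Real.exp x ^ 2 by rw [← Real.exp_nat_mul]; norm_num]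
            ring
    calc xiKernel (Real.exp x) * Real.exp ((A + 1) * x ^ 2)
        ≤ 4 * Real.pi ^ 2 * C * (Real.exp (2 * x) * Real.exp (-2 * Real.exp x)) *
          Real.exp ((A + 1) * x ^ 2) := by gcongr
      _ = 4 * Real.pi ^ 2 * C * Real.exp (2 * x + -2 * Real.exp x + (A + 1) * x ^ 2) := by
          rw [Real.exp_add, Real.exp_add]; ring
      _ ≤ _ := by
          refine mul_le_mul_of_nonneg_left (Real.exp_le_exp.2 ?_) (by positivity)
          have h3 := Real.pow_div_factorial_le_exp x hx 3
          have h4 : (Nat.factorial 3 : ℝ) = 6 := by norm_num [Nat.factorial]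
          rw [h4] at h3
          have h5 : A ≤ |A| := le_abs_self A
          -- The cubic `x³/3` is what `2 exp x` provides; `c` exceeds `A + 1` by enough to absorb
          -- `2x ≤ x² + 1`.
          have h6 : c * x ^ 2 ≤ x ^ 3 / 3 + 9 * c ^ 3 := by
            rcases le_total x (3 * c) with h | h
            · have : c * x ^ 2 ≤ c * (3 * c) ^ 2 := by gcongr
              have : 0 ≤ x ^ 3 / 3 := by positivity
              nlinarith
            · have : 0 ≤ x ^ 2 * (x - 3 * c) := mul_nonneg (sq_nonneg x) (by linarith)
              have : 0 < 9 * c ^ 3 := by positivity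
              nlinarith
          nlinarith [sq_nonneg (x - 1), mul_nonneg (sub_nonneg.2 h5) (sq_nonneg x)]
  refine ⟨4 * Real.pi ^ 2 * C * Real.exp (1 + 9 * c ^ 3) * Real.exp 1, fun x => ?_⟩
  have hone : (1 : ℝ) ≤ Real.exp 1 := Real.one_le_exp zero_le_one
  rcases le_total 0 x with hx | hx
  · refine le_trans ?_ (le_mul_of_one_le_right (by positivity) hone)
    refine le_trans ?_ (hpos x hx)
    have := (xiKernel_pos (Real.exp_pos x)).le
    gcongr
    linarith
  -- The spare `x²` in `A + 1` absorbs the factor `exp(-x/2)` coming from inversion.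
  · have h1 := xiKernel_exp_neg (-x)
    rw [neg_neg] at h1
    have h2 := hpos (-x) (by linarith)
    have h3 := (xiKernel_pos (Real.exp_pos (-x))).le
    rw [h1]
    calc Real.exp (-x / 2) * xiKernel (Real.exp (-x)) * Real.exp (A * x ^ 2)
        = xiKernel (Real.exp (-x)) * Real.exp (-x / 2 + A * x ^ 2) := by rw [Real.exp_add]; ring
      _ ≤ xiKernel (Real.exp (-x)) * Real.exp ((A + 1) * (-x) ^ 2 + 1) := by
          refine mul_le_mul_of_nonneg_left (Real.exp_le_exp.2 ?_) h3
          nlinarith [sq_nonneg (x + 1 / 2)]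
      _ = xiKernel (Real.exp (-x)) * Real.exp ((A + 1) * (-x) ^ 2) * Real.exp 1 := by
          rw [Real.exp_add]; ring
      _ ≤ _ := by gcongr

/-! ### The Mellin transform of the kernel. -/

theorem continuousOn_thetaMoment (k : ℕ) : ContinuousOn (thetaMoment k) (Ioi 0) := fun _ ht =>
  (hasDerivAt_thetaMoment k ht).continuousAt.continuousWithinAt

theorem continuousOn_xiKernel : ContinuousOn xiKernel (Ioi 0) := by
  have h1 := continuousOn_thetaMoment 1
  have h2 := continuousOn_thetaMoment 2
  unfold xiKernel
  fun_prop

/-- The kernel with a logarithmic Gaussian weight. -/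
noncomputable def weightedXiKernel (A : ℝ) (t : ℝ) : ℝ :=
  xiKernel t * Real.exp (A * Real.log t ^ 2)

theorem exists_weightedXiKernel_le (A a : ℝ) :
    ∃ C : ℝ, ∀ t : ℝ, 0 < t → |weightedXiKernel A t| ≤ C * |t ^ (-a)| := by
  obtain ⟨C, hC⟩ := exists_xiKernel_exp_mul_le (A + 1)
  refine ⟨C * Real.exp (a ^ 2 / 4), fun t ht => ?_⟩
  have hK := xiKernel_pos ht
  have h := hC (Real.log t)
  rw [Real.exp_log ht] at h
  rw [weightedXiKernel, abs_of_pos (by positivity), abs_of_pos (by positivity), Real.rpow_def_of_pos ht,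
    mul_assoc, ← Real.exp_add]
  calc xiKernel t * Real.exp (A * Real.log t ^ 2)
      ≤ xiKernel t * Real.exp ((A + 1) * Real.log t ^ 2 + (a ^ 2 / 4 + Real.log t * -a)) := by
        gcongr
        nlinarith [sq_nonneg (Real.log t - a / 2)]
    _ = xiKernel t * Real.exp ((A + 1) * Real.log t ^ 2) *
        Real.exp (a ^ 2 / 4 + Real.log t * -a) := by rw [Real.exp_add]; ring
    _ ≤ _ := by gcongr

theorem continuousOn_weightedXiKernel (A : ℝ) :
    ContinuousOn (fun t => (weightedXiKernel A t : ℂ)) (Ioi 0) := by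
  refine Complex.continuous_ofReal.comp_continuousOn (continuousOn_xiKernel.mul ?_)
  exact Real.continuous_exp.comp_continuousOn
    (continuousOn_const.mul ((Real.continuousOn_log.mono fun t ht => ne_of_gt ht).pow 2))

theorem isBigO_atTop_weightedXiKernel (A a : ℝ) :
    (fun t => (weightedXiKernel A t : ℂ)) =O[atTop] fun t : ℝ => t ^ (-a) := by
  obtain ⟨C, hC⟩ := exists_weightedXiKernel_le A a
  refine Asymptotics.IsBigO.of_bound C ?_
  filter_upwards [eventually_gt_atTop 0] with t ht
  simpa using hC t ht

theorem isBigO_zero_weightedXiKernel (A a : ℝ) :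
    (fun t => (weightedXiKernel A t : ℂ)) =O[𝓝[>] 0] fun t : ℝ => t ^ (-a) := by
  obtain ⟨C, hC⟩ := exists_weightedXiKernel_le A a
  refine Asymptotics.IsBigO.of_bound C ?_
  filter_upwards [self_mem_nhdsWithin] with t ht
  simpa using hC t ht

theorem mellinConvergent_weightedXiKernel (A : ℝ) (s : ℂ) :
    MellinConvergent (fun t => (weightedXiKernel A t : ℂ)) s :=
  mellinConvergent_of_isBigO_rpow
    ((continuousOn_weightedXiKernel A).locallyIntegrableOn measurableSet_Ioi)
    (isBigO_atTop_weightedXiKernel A (s.re + 1)) (by linarith)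
    (isBigO_zero_weightedXiKernel A (s.re - 1)) (by linarith)

theorem weightedXiKernel_zero (t : ℝ) : weightedXiKernel 0 t = xiKernel t := by
  simp [weightedXiKernel]

theorem mellinConvergent_xiKernel (s : ℂ) : MellinConvergent (fun t => (xiKernel t : ℂ)) s := by
  simpa only [weightedXiKernel_zero] using mellinConvergent_weightedXiKernel 0 s

theorem differentiable_mellin_xiKernel :
    Differentiable ℂ (mellin fun t => (xiKernel t : ℂ)) := by
  intro s
  have := mellin_differentiableAt_of_isBigO_rpow
    ((continuousOn_weightedXiKernel 0).locallyIntegrableOn measurableSet_Ioi)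
    (isBigO_atTop_weightedXiKernel 0 (s.re + 1)) (by linarith)
    (isBigO_zero_weightedXiKernel 0 (s.re - 1)) (by linarith)
  simpa only [weightedXiKernel_zero] using this

theorem mellinConvergent_thetaMoment (k : ℕ) {s : ℂ} (hs : k + 1 < s.re) :
    MellinConvergent (fun t => (thetaMoment k t : ℂ)) s := by
  have hc : ContinuousOn (fun t => (thetaMoment k t : ℂ)) (Ioi 0) :=
    Complex.continuous_ofReal.comp_continuousOn (continuousOn_thetaMoment k)
  obtain ⟨C, -, hC⟩ := exists_thetaMoment_le_exp k
  obtain ⟨D, hD⟩ := exists_thetaMoment_le_inv_pow k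
  refine mellinConvergent_of_isBigO_rpow_exp (a := 2) (b := k + 1) two_pos
    (hc.locallyIntegrableOn measurableSet_Ioi) ?_ ?_ hs
  · refine Asymptotics.IsBigO.of_bound C ?_
    filter_upwards [eventually_ge_atTop 1] with t ht
    rw [Complex.norm_real, Real.norm_of_nonneg (thetaMoment_pos k (by linarith)).le,
      Real.norm_of_nonneg (Real.exp_pos _).le]
    exact hC t ht
  · refine Asymptotics.IsBigO.of_bound D ?_
    filter_upwards [self_mem_nhdsWithin] with t (ht : 0 < t)
    rw [Complex.norm_real, Real.norm_of_nonneg (thetaMoment_pos k ht).le,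
      Real.norm_of_nonneg (by positivity), Real.rpow_neg ht.le]
    exact_mod_cast hD t ht

/-- Termwise Gamma integrals: the weight `m^(2k)` cancels the shift by `k`, so the same `ζ(s)`
appears for each `k`. -/
theorem mellin_thetaMoment (k : ℕ) {s : ℂ} (hs : 1 < s.re) :
    mellin (fun t => (thetaMoment k t : ℂ)) (s / 2 + k) =
      (Real.pi : ℂ) ^ (-(s / 2 + k)) * Complex.Gamma (s / 2 + k) * riemannZeta s := by
  have hre : (s / 2 + k).re = s.re / 2 + k := by simp
  have hk : (0 : ℝ) ≤ k := k.cast_nonneg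
  have h := hasSum_mellin_pi_mul (a := fun n : ℕ => ((n : ℂ) + 1) ^ (2 * k))
    (q := fun n : ℕ => ((n : ℝ) + 1) ^ 2) (F := fun t => (thetaMoment k t : ℂ)) (s := s / 2 + k)
    (fun n => Or.inr (by positivity)) (by rw [hre]; linarith)
    (fun t ht => by
      have := (summable_thetaMoment k ht).hasSum
      rw [← Complex.hasSum_ofReal] at this
      simpa [thetaMoment] using this)
    (by
      have : Summable fun n : ℕ => 1 / ((n : ℝ) + 1) ^ s.re := by
        have := (summable_nat_add_iff 1).2 (Real.summable_one_div_nat_rpow.2 hs)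
        simpa using this
      convert this using 2 with n
      have hn : (0 : ℝ) < (n : ℝ) + 1 := by positivity
      rw [hre, norm_pow, show ‖(n : ℂ) + 1‖ = (n : ℝ) + 1 by
        rw [← Nat.cast_succ, Complex.norm_natCast, Nat.cast_succ],
        ← Real.rpow_natCast _ 2, ← Real.rpow_mul hn.le, ← Real.rpow_natCast _ (2 * k),
        ← Real.rpow_sub hn, one_div, ← Real.rpow_neg hn.le]
      congr 1
      push_cast
      ring)
  rw [← h.tsum_eq, zeta_eq_tsum_one_div_nat_add_one_cpow hs, ← tsum_mul_left]
  congr 1 with n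
  have hn : (n : ℂ) + 1 ≠ 0 := Nat.cast_add_one_ne_zero n
  have e : (((((n : ℝ) + 1) ^ 2 : ℝ)) : ℂ) ^ (s / 2 + k) =
      ((n : ℂ) + 1) ^ s * ((n : ℂ) + 1) ^ (2 * k) := by
    have : (((((n : ℝ) + 1) ^ 2 : ℝ)) : ℂ) = ((n + 1 : ℕ) : ℂ) ^ 2 := by push_cast; ring
    rw [this, ← Complex.natCast_cpow_natCast_mul, ← Nat.cast_succ, ← Complex.cpow_natCast,
      ← Complex.cpow_add _ _ (by exact_mod_cast n.succ_ne_zero)]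
    congr 1
    push_cast
    ring
  rw [e]
  field_simp

/-- The Gamma recursion yields the factor `4(s/2)(s/2 + 1) - 6(s/2) = s(s - 1)`. The half-plane
reflects the crude bound at `t = 0`; `mellin_xiKernel` removes it by the identity theorem. -/
theorem mellin_xiKernel_of_two_lt_re {s : ℂ} (hs : 2 < s.re) :
    mellin (fun t => (xiKernel t : ℂ)) (s / 2) = 2 * riemannEta s := by
  have hre : ∀ k : ℕ, (s / 2 + k).re = s.re / 2 + k := fun k => by simp
  have h1 : MellinConvergent (fun t : ℝ => (6 * Real.pi : ℂ) • ((t : ℂ) ^ ((1 : ℕ) : ℂ) •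
      (thetaMoment 1 t : ℂ))) (s / 2) :=
    (MellinConvergent.cpow_smul.2 (mellinConvergent_thetaMoment 1 (by rw [hre]; push_cast; linarith))).const_smul _
  have h2 : MellinConvergent (fun t : ℝ => (4 * Real.pi ^ 2 : ℂ) • ((t : ℂ) ^ ((2 : ℕ) : ℂ) •
      (thetaMoment 2 t : ℂ))) (s / 2) :=
    (MellinConvergent.cpow_smul.2 (mellinConvergent_thetaMoment 2 (by rw [hre]; push_cast; linarith))).const_smul _
  have h := (hasMellin_sub h2 h1).2
  rw [mellin_const_smul, mellin_const_smul, mellin_cpow_smul, mellin_cpow_smul,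
    mellin_thetaMoment 1 (by linarith), mellin_thetaMoment 2 (by linarith)] at h
  have e : (fun t => (xiKernel t : ℂ)) = fun t : ℝ =>
      (4 * Real.pi ^ 2 : ℂ) • ((t : ℂ) ^ ((2 : ℕ) : ℂ) • (thetaMoment 2 t : ℂ)) -
      (6 * Real.pi : ℂ) • ((t : ℂ) ^ ((1 : ℕ) : ℂ) • (thetaMoment 1 t : ℂ)) := by
    funext t
    simp only [xiKernel, Complex.cpow_natCast, smul_eq_mul]
    push_cast
    ring
  rw [e, h, riemannEta_eq s (by rintro rfl; norm_num at hs) (fun n => by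
    rintro rfl
    simp at hs
    linarith [n.cast_nonneg (α := ℝ)])]
  have hs0 : s / 2 ≠ 0 := by
    intro h; have := congrArg Complex.re h; simp at this; linarith
  have hs1 : s / 2 + 1 ≠ 0 := by
    intro h; have := congrArg Complex.re h; simp at this; linarith
  have hpi : (Real.pi : ℂ) ≠ 0 := by exact_mod_cast Real.pi_ne_zero
  have g1 : Complex.Gamma (s / 2 + (1 : ℕ)) = s / 2 * Complex.Gamma (s / 2) := by
    push_cast; exact Complex.Gamma_add_one _ hs0
  have g2 : Complex.Gamma (s / 2 + (2 : ℕ)) = (s / 2 + 1) * (s / 2 * Complex.Gamma (s / 2)) := by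
    rw [← Complex.Gamma_add_one _ hs0, ← Complex.Gamma_add_one _ hs1]
    push_cast; ring_nf
  have p (k : ℕ) : (Real.pi : ℂ) ^ (-(s / 2 + k)) = (Real.pi : ℂ) ^ (-s / 2) / (Real.pi : ℂ) ^ k := by
    rw [← Complex.cpow_natCast, ← Complex.cpow_sub _ _ hpi]; congr 1; ring
  rw [g1, g2, p, p]
  simp only [smul_eq_mul]
  field_simp
  ring

theorem mellin_xiKernel (s : ℂ) :
    mellin (fun t => (xiKernel t : ℂ)) (s / 2) = 2 * riemannEta s := by
  have h1 : AnalyticOnNhd ℂ (fun s => mellin (fun t => (xiKernel t : ℂ)) (s / 2)) univ := fun z _ =>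
    (differentiable_mellin_xiKernel.comp (differentiable_id.div_const 2)).analyticAt z
  have h2 : AnalyticOnNhd ℂ (fun s => 2 * riemannEta s) univ := fun z _ =>
    (differentiable_riemannEta.const_mul 2).analyticAt z
  have h3 : (fun s => mellin (fun t => (xiKernel t : ℂ)) (s / 2)) =ᶠ[𝓝 3] fun s => 2 * riemannEta s := by
    filter_upwards [(isOpen_lt continuous_const Complex.continuous_re).mem_nhds
      (show (2 : ℝ) < (3 : ℂ).re by norm_num)] with z hz
    exact mellin_xiKernel_of_two_lt_re hz
  exact congrFun (h1.eq_of_eventuallyEq h2 h3) s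

/-! ### Criteria for the Laguerre–Pólya class and for positive definiteness. -/

theorem mem_laguerrePolya_of_even {φ : ℂ → ℂ} (hd : Differentiable ℂ φ)
    (heven : ∀ z, φ (-z) = φ z) (h0 : φ 0 = 1) (hreal : ∀ z, φ z = 0 → z.im = 0)
    (hb : ∀ ε > 0, ∃ C : ℝ, ∀ z, ‖φ z‖ ≤ C * Real.exp (ε * ‖z‖ ^ 2)) : φ ∈ LaguerrePolya := by
  obtain ⟨g, hg, hgφ⟩ := exists_differentiable_comp_sq hd heven
  have hsqrt : ∀ w : ℂ, ∃ z : ℂ, w = z ^ 2 := fun w =>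
    ⟨w ^ (1 / 2 : ℂ), by simp [← Complex.cpow_nat_mul]⟩
  have hg0 : g 0 = 1 := by simpa [h0] using hgφ 0
  obtain ⟨s, hs, hlim⟩ := exists_tendstoLocallyUniformly_prod_zeros hg hg0 (fun ε hε => by
    obtain ⟨C, hC⟩ := hb ε hε
    refine ⟨C, fun w => ?_⟩
    obtain ⟨z, rfl⟩ := hsqrt w
    rw [hgφ, norm_pow]
    exact hC z)
  have hzero : ∀ n, ∀ a ∈ s n, ∃ x : ℝ, x ≠ 0 ∧ a = (x : ℂ) ^ 2 := by
    intro n a ha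
    obtain ⟨z, rfl⟩ := hsqrt a
    have hz : φ z = 0 := by rw [← hgφ]; exact hs n _ ha
    have hzx : z = (z.re : ℂ) := by
      apply Complex.ext <;> simp [hreal z hz]
    refine ⟨z.re, fun h => ?_, by rw [← hzx]⟩
    rw [hzx, h, Complex.ofReal_zero, h0] at hz
    exact one_ne_zero hz
  -- Each `a` is the square of a nonzero real, so taking `a.re` loses nothing and makes the
  -- coefficients real.
  set p : ℕ → Polynomial ℝ := fun n =>
    ((s n).map fun a => 1 - Polynomial.C (a.re⁻¹) * Polynomial.X ^ 2).prod with hp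
  have hpz : ∀ n (z : ℂ), Polynomial.aeval z (p n) = ((s n).map fun a => 1 - z ^ 2 / a).prod := by
    intro n z
    rw [hp, map_multiset_prod, Multiset.map_map]
    congr 1
    refine Multiset.map_congr rfl fun a ha => ?_
    obtain ⟨x, hx, rfl⟩ := hzero n a ha
    have : ((x : ℂ) ^ 2).re = x ^ 2 := by rw [← Complex.ofReal_pow, Complex.ofReal_re]
    simp only [Function.comp_apply, map_sub, map_one, map_mul, map_pow, Polynomial.aeval_X,
      Polynomial.aeval_C, this, Complex.coe_algebraMap, Complex.ofReal_inv, Complex.ofReal_pow]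
    ring
  refine ⟨hd, p, fun n z hz => ?_, ?_⟩
  · rw [hpz, Multiset.prod_eq_zero_iff, Multiset.mem_map] at hz
    obtain ⟨a, ha, haz⟩ := hz
    obtain ⟨x, hx, rfl⟩ := hzero n a ha
    have hx' : (x : ℂ) ^ 2 ≠ 0 := by simpa using hx
    have h2 : z ^ 2 = (x : ℂ) ^ 2 := by
      rw [sub_eq_zero, eq_comm, div_eq_one_iff_eq hx'] at haz
      exact haz
    rcases sq_eq_sq_iff_eq_or_eq_neg.1 h2 with rfl | rfl <;> simp
  · have := hlim.comp (fun z : ℂ => z ^ 2) (by fun_prop)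
    refine (this.congr fun n z => ?_).congr_right fun z => hgφ z
    simp [hpz]

-- The easy half of Bochner's theorem: the double sum is the integral of `W |∑ c_j exp(i t_j L)|²`.
open scoped ComplexOrder in
open MeasureTheory in
theorem sum_mul_integral_exp_nonneg {α : Type*} [MeasurableSpace α] {μ : Measure α} {W L : α → ℝ}
    (hW : Integrable W μ) (hW0 : 0 ≤ᵐ[μ] W) (hL : Measurable L) {n : ℕ} (t : Fin n → ℝ)
    (c : Fin n → ℂ) :
    0 ≤ ∑ j, ∑ k, c j * (starRingEnd ℂ) (c k) *
      ∫ x, (W x : ℂ) * Complex.exp (((t j - t k : ℝ) : ℂ) * L x * Complex.I) ∂μ := by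
  have hint : ∀ r : ℝ, Integrable
      (fun x => (W x : ℂ) * Complex.exp ((r : ℂ) * L x * Complex.I)) μ := by
    intro r
    refine hW.ofReal.mul_bdd (c := 1) ?_ (ae_of_all _ fun x => ?_)
    · exact (by fun_prop : Measurable fun x =>
        Complex.exp ((r : ℂ) * L x * Complex.I)).aestronglyMeasurable
    · rw [← Complex.ofReal_mul, Complex.norm_exp_ofReal_mul_I]
  have hsum : ∑ j, ∑ k, c j * (starRingEnd ℂ) (c k) *
      ∫ x, (W x : ℂ) * Complex.exp (((t j - t k : ℝ) : ℂ) * L x * Complex.I) ∂μ =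
      ∫ x, ((W x * Complex.normSq (∑ j, c j * Complex.exp ((t j : ℂ) * L x * Complex.I)) : ℝ) : ℂ)
        ∂μ := by
    have hint' : ∀ j k, Integrable (fun x => c j * (starRingEnd ℂ) (c k) *
        ((W x : ℂ) * Complex.exp (((t j - t k : ℝ) : ℂ) * L x * Complex.I))) μ :=
      fun j k => (hint _).const_mul _
    simp_rw [← integral_const_mul]
    simp_rw [← integral_finsetSum _ fun k _ => hint' _ k]
    rw [← integral_finsetSum _ fun j _ => integrable_finsetSum _ fun k _ => hint' j k]
    congr 1 with x
    rw [Complex.ofReal_mul, Complex.normSq_eq_conj_mul_self, mul_comm (starRingEnd ℂ _), map_sum,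
      Finset.sum_mul_sum, Finset.mul_sum]
    refine Finset.sum_congr rfl fun j _ => ?_
    rw [Finset.mul_sum]
    refine Finset.sum_congr rfl fun k _ => ?_
    have he : Complex.exp (((t j - t k : ℝ) : ℂ) * L x * Complex.I) =
        Complex.exp ((t j : ℂ) * L x * Complex.I) *
          (starRingEnd ℂ) (Complex.exp ((t k : ℂ) * L x * Complex.I)) := by
      rw [← Complex.exp_conj, ← Complex.exp_add]
      congr 1
      simp only [map_mul, Complex.conj_ofReal, Complex.conj_I]
      push_cast
      ring
    rw [he, map_mul]
    ring
  rw [hsum, integral_complex_ofReal, Complex.zero_le_real]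
  refine integral_nonneg_of_ae ?_
  filter_upwards [hW0] with x hx
  exact mul_nonneg hx (Complex.normSq_nonneg _)

/-! ### Growth and Fourier representation of `ξ`. -/

theorem landauXi_eq_mellin (z : ℂ) : landauXi z =
    (1 / 2) * mellin (fun t => (xiKernel t : ℂ)) (1 / 4 + Complex.I * z / 2) := by
  have := mellin_xiKernel (1 / 2 + Complex.I * z)
  rw [landauXi, show (1 / 4 + Complex.I * z / 2 : ℂ) = (1 / 2 + Complex.I * z) / 2 by ring, this]
  ring

theorem differentiable_landauXi : Differentiable ℂ landauXi := by
  have := differentiable_riemannEta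
  unfold landauXi
  fun_prop

theorem riemannEta_one_sub (s : ℂ) : riemannEta (1 - s) = riemannEta s := by
  rw [riemannEta, riemannEta, completedRiemannZeta₀_one_sub]
  ring

theorem landauXi_neg (z : ℂ) : landauXi (-z) = landauXi z := by
  rw [landauXi, landauXi, ← riemannEta_one_sub]
  congr 1
  ring

theorem exists_norm_landauXi_le {ε : ℝ} (hε : 0 < ε) :
    ∃ C : ℝ, ∀ z, ‖landauXi z‖ ≤ C * Real.exp (ε * ‖z‖ ^ 2) := by
  -- Then `Aε = 1/16`, which is what `|log t| ‖z‖ / 2 ≤ A log² t + ε ‖z‖²` needs.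
  set A : ℝ := 1 / (16 * ε) with hA
  have hi := (mellinConvergent_weightedXiKernel A (1 / 4)).norm
  refine ⟨(1 / 2) * ∫ t in Ioi (0 : ℝ), ‖(t : ℂ) ^ ((1 / 4 : ℂ) - 1) • (weightedXiKernel A t : ℂ)‖,
    fun z => ?_⟩
  rw [landauXi_eq_mellin, norm_mul, mul_assoc, ← MeasureTheory.integral_mul_const]
  rw [show ‖(1 / 2 : ℂ)‖ = 1 / 2 by norm_num]
  refine mul_le_mul_of_nonneg_left ?_ (by norm_num)
  refine MeasureTheory.norm_integral_le_of_norm_le (hi.mul_const _) ?_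
  filter_upwards [MeasureTheory.ae_restrict_mem measurableSet_Ioi] with t (ht : 0 < t)
  have hK := (xiKernel_pos ht).le
  have h1 : |(Complex.I * z / 2).re| ≤ ‖z‖ / 2 := by
    refine (Complex.abs_re_le_norm _).trans (le_of_eq ?_)
    simp
  rw [norm_smul, norm_smul, Complex.norm_cpow_eq_rpow_re_of_pos ht,
    Complex.norm_cpow_eq_rpow_re_of_pos ht, Complex.norm_real, Complex.norm_real, weightedXiKernel,
    Real.norm_of_nonneg hK, Real.norm_of_nonneg (by positivity)]
  rw [show (1 / 4 + Complex.I * z / 2 - 1).re = ((1 / 4 : ℂ) - 1).re + (Complex.I * z / 2).re by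
    simp only [Complex.add_re, Complex.sub_re]; ring, Real.rpow_add ht]
  have h2 : t ^ (Complex.I * z / 2).re ≤
      Real.exp (A * Real.log t ^ 2) * Real.exp (ε * ‖z‖ ^ 2) := by
    rw [Real.rpow_def_of_pos ht, ← Real.exp_add, Real.exp_le_exp]
    calc Real.log t * (Complex.I * z / 2).re ≤ |Real.log t| * |(Complex.I * z / 2).re| := by
          rw [← abs_mul]; exact le_abs_self _
      _ ≤ |Real.log t| * (‖z‖ / 2) := by gcongr
      _ ≤ A * |Real.log t| ^ 2 + ε * ‖z‖ ^ 2 := by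
          have h3 : 0 ≤ A * (|Real.log t| - 4 * ε * ‖z‖) ^ 2 := by positivity
          have h4 : A * ε = 1 / 16 := by rw [hA]; field_simp
          linear_combination h3 + (-8 * |Real.log t| * ‖z‖ + 16 * ε * ‖z‖ ^ 2) * h4
      _ = _ := by rw [sq_abs]
  calc t ^ ((1 / 4 : ℂ) - 1).re * t ^ (Complex.I * z / 2).re * xiKernel t
      ≤ t ^ ((1 / 4 : ℂ) - 1).re * (Real.exp (A * Real.log t ^ 2) * Real.exp (ε * ‖z‖ ^ 2)) *
        xiKernel t := by gcongr
    _ = _ := by ring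

/-- The density in the Fourier representation of `ξ`. -/
noncomputable def xiDensity (t : ℝ) : ℝ := (1 / 2) * (t ^ (-3 / 4 : ℝ) * xiKernel t)

theorem xiDensity_pos {t : ℝ} (ht : 0 < t) : 0 < xiDensity t := by
  have := xiKernel_pos ht
  unfold xiDensity
  positivity

theorem integrableOn_xiDensity : MeasureTheory.IntegrableOn xiDensity (Ioi 0) := by
  have h := ((mellinConvergent_xiKernel (1 / 4)).norm).const_mul (1 / 2)
  refine MeasureTheory.IntegrableOn.congr_fun h (fun t (ht : 0 < t) => ?_) measurableSet_Ioi
  simp only [norm_smul, Complex.norm_cpow_eq_rpow_re_of_pos ht, Complex.norm_real,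
    Real.norm_of_nonneg (xiKernel_pos ht).le, xiDensity]
  norm_num

theorem landauXi_ofReal (r : ℝ) : landauXi r = ∫ t in Ioi (0 : ℝ),
    (xiDensity t : ℂ) * Complex.exp ((r : ℂ) * (Real.log t / 2 : ℝ) * Complex.I) := by
  rw [landauXi_eq_mellin, mellin, ← MeasureTheory.integral_const_mul]
  refine MeasureTheory.setIntegral_congr_fun measurableSet_Ioi fun t (ht : 0 < t) => ?_
  have ht' : (t : ℂ) ≠ 0 := by exact_mod_cast ht.ne'
  have h1 : (t : ℂ) ^ (1 / 4 + Complex.I * r / 2 - 1 : ℂ) = ((t ^ (-3 / 4 : ℝ) : ℝ) : ℂ) *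
      Complex.exp ((r : ℂ) * (Real.log t / 2 : ℝ) * Complex.I) := by
    rw [Complex.ofReal_cpow ht.le, show (1 / 4 + Complex.I * r / 2 - 1 : ℂ) =
      ((-3 / 4 : ℝ) : ℂ) + Complex.I * r / 2 by push_cast; ring, Complex.cpow_add _ _ ht',
      Complex.cpow_def_of_ne_zero ht' (Complex.I * r / 2), ← Complex.ofReal_log ht.le]
    congr 2
    push_cast
    ring
  simp only [h1, xiDensity, smul_eq_mul]
  push_cast
  ring

theorem exists_landauXi_zero_eq : ∃ c : ℝ, 0 < c ∧ landauXi 0 = c := by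
  refine ⟨∫ t in Ioi (0 : ℝ), xiDensity t, ?_, ?_⟩
  · rw [MeasureTheory.setIntegral_pos_iff_support_of_nonneg_ae ?_ integrableOn_xiDensity]
    · have : Function.support xiDensity ∩ Ioi 0 = Ioi 0 :=
        inter_eq_right.2 fun t ht => (xiDensity_pos ht).ne'
      rw [this]
      simp
    · filter_upwards [MeasureTheory.ae_restrict_mem measurableSet_Ioi] with t ht
      exact (xiDensity_pos ht).le
  · have := landauXi_ofReal 0
    simpa [integral_complex_ofReal] using this

open scoped ComplexOrder in
theorem landauXi_div_mem_normalizedPosDef :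
    (fun t : ℝ => landauXi t / landauXi 0) ∈ NormalizedPosDef := by
  obtain ⟨c, hc, hc0⟩ := exists_landauXi_zero_eq
  have hL : Measurable fun t : ℝ => Real.log t / 2 := by fun_prop
  have hnn : 0 ≤ᵐ[MeasureTheory.volume.restrict (Ioi 0)] xiDensity := by
    filter_upwards [MeasureTheory.ae_restrict_mem measurableSet_Ioi] with t ht
    exact (xiDensity_pos ht).le
  refine ⟨?_, ⟨(∫ t in Ioi (0 : ℝ), ‖xiDensity t‖) / c, fun r => ?_⟩, fun n t a => ?_, ?_⟩
  · have := differentiable_landauXi.continuous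
    fun_prop
  · rw [norm_div, hc0, Complex.norm_real, Real.norm_of_nonneg hc.le, landauXi_ofReal]
    gcongr
    refine (MeasureTheory.norm_integral_le_integral_norm _).trans (le_of_eq ?_)
    congr 1 with t
    rw [norm_mul, ← Complex.ofReal_mul, Complex.norm_exp_ofReal_mul_I, mul_one, Complex.norm_real]
  · have h := sum_mul_integral_exp_nonneg integrableOn_xiDensity hnn hL t a
    simp only [← landauXi_ofReal] at h
    simp only [← mul_div_assoc, ← Finset.sum_div]
    rw [hc0]
    exact div_nonneg h (by exact_mod_cast hc.le)
  · simp only [Complex.ofReal_zero, hc0]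
    exact div_self (by exact_mod_cast hc.ne')

/-! ### Zeros of `η` and the Riemann hypothesis. -/

theorem riemannEta_ne_zero_of_one_le_re {s : ℂ} (hs : 1 ≤ s.re) : riemannEta s ≠ 0 := by
  by_cases h1 : s = 1
  · simp [h1, riemannEta]
  have hs0 : s ≠ 0 := by rintro rfl; norm_num at hs
  have hpos : ∀ n : ℕ, s ≠ -2 * (n : ℂ) := by
    rintro n rfl
    simp at hs
    linarith [n.cast_nonneg (α := ℝ)]
  rw [riemannEta_eq s h1 hpos]
  have hpi : (Real.pi : ℂ) ≠ 0 := by exact_mod_cast Real.pi_ne_zero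
  have hΓ : Complex.Gamma (s / 2) ≠ 0 := Complex.Gamma_ne_zero_of_re_pos (by simp; linarith)
  have hζ := riemannZeta_ne_zero_of_one_le_re hs
  have h1' := sub_ne_zero.2 h1
  have := (Complex.cpow_ne_zero_iff (y := -s / 2)).2 (Or.inl hpi)
  simp [*]

theorem re_eq_half_of_riemannEta_eq_zero (hRH : RiemannHypothesis) {s : ℂ}
    (hs : riemannEta s = 0) : s.re = 1 / 2 := by
  have h1 : s.re < 1 := by
    by_contra h
    exact riemannEta_ne_zero_of_one_le_re (not_lt.1 h) hs
  have h0 : 0 < s.re := by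
    by_contra h
    refine riemannEta_ne_zero_of_one_le_re (s := 1 - s) ?_ (by rwa [riemannEta_one_sub])
    simp
    linarith
  have hne1 : s ≠ 1 := by rintro rfl; simp at h1
  have hne0 : s ≠ 0 := by rintro rfl; simp at h0
  have hpos : ∀ n : ℕ, s ≠ -2 * (n : ℂ) := by
    rintro n rfl
    simp at h0
    linarith [n.cast_nonneg (α := ℝ)]
  have hpi : (Real.pi : ℂ) ≠ 0 := by exact_mod_cast Real.pi_ne_zero
  have hΓ : Complex.Gamma (s / 2) ≠ 0 := Complex.Gamma_ne_zero_of_re_pos (by simpa using h0)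
  rw [riemannEta_eq s hne1 hpos] at hs
  refine hRH s ?_ ?_ hne1
  · have h1' := sub_ne_zero.2 hne1
    have := (Complex.cpow_ne_zero_iff (y := -s / 2)).2 (Or.inl hpi)
    simpa [*] using hs
  · rintro ⟨n, hn⟩
    exact hpos (n + 1) (by rw [hn]; push_cast; ring)

theorem riemannHypothesis_of_mem_laguerrePolya
    (h : (fun z : ℂ => landauXi z / landauXi 0) ∈ LaguerrePolya) : RiemannHypothesis := by
  intro s hs htriv hs1
  obtain ⟨c, hc, hc0⟩ := exists_landauXi_zero_eq
  have hc' : landauXi 0 ≠ 0 := by rw [hc0]; exact_mod_cast hc.ne'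
  have hpos : ∀ n : ℕ, s ≠ -2 * (n : ℂ) := by
    -- The index `0` is the point `s = 0`, where `ζ(0) = -1/2`; the others are trivial zeros.
    rintro (_ | n) rfl
    · simp [riemannZeta_zero] at hs
    · exact htriv ⟨n, by push_cast; ring⟩
  have hz : landauXi (-Complex.I * (s - 1 / 2)) = 0 := by
    rw [landauXi, show 1 / 2 + Complex.I * (-Complex.I * (s - 1 / 2)) = s by
      linear_combination (-(s - 1 / 2)) * Complex.I_mul_I, riemannEta_eq s hs1 hpos, hs, mul_zero]
  have := LaguerrePolya.im_eq_zero h (by simp [hc']) (z := -Complex.I * (s - 1 / 2))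
    (by simp only [hz, zero_div])
  simp at this
  linarith

theorem mainTheorem6 :
    (fun z : ℂ => landauXi z / landauXi 0) ∈ LukacsClass ↔ RiemannHypothesis := by
  refine ⟨fun h => riemannHypothesis_of_mem_laguerrePolya h.1.1, fun hRH => ?_⟩
  obtain ⟨c, hc, hc0⟩ := exists_landauXi_zero_eq
  have hc' : landauXi 0 ≠ 0 := by rw [hc0]; exact_mod_cast hc.ne'
  have heven : ∀ z, landauXi (-z) / landauXi 0 = landauXi z / landauXi 0 := fun z => by
    rw [landauXi_neg]
  refine ⟨⟨mem_laguerrePolya_of_even (differentiable_landauXi.div_const _) heven (div_self hc')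
    (fun z hz => ?_) (fun ε hε => ?_), heven, div_self hc'⟩, landauXi_div_mem_normalizedPosDef⟩
  · have hz' : landauXi z = 0 := by simpa [hc'] using hz
    have := re_eq_half_of_riemannEta_eq_zero hRH hz'
    simpa using this
  · obtain ⟨C, hC⟩ := exists_norm_landauXi_le hε
    refine ⟨C / c, fun z => ?_⟩
    rw [norm_div, hc0, Complex.norm_real, Real.norm_of_nonneg hc.le, div_mul_eq_mul_div]
    gcongr
    exact hC z
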